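/- Let $\mathbb{F}_q$ be a finite field, $L/\mathbb{F}_q$ a finite extension with $[L:\mathbb{F}_q]$ odd, and $\overline L$ an algebraic closure of $L$. Let $\tau\colon x\mapsto x^q$ on $\overline L$ and, for a field $L\subseteq K\subseteq\overline L$, let $K\{\tau\}$ be the ring of $\mathbb{F}_q$-linear endomorphisms of $\overline L$ of the form $\sum_{i=0}^n a_i\tau^i$ with $a_i\in K$ (under addition and composition). Let $\gamma\colon\mathbb{F}_q[X]\to L$ be an $\mathbb{F}_q$-algebra morphism (its kernel $\mathfrak p$ is then a nonzero prime ideal), and let $\phi\colon\mathbb{F}_q[X]\to L\{\tau\}$, $a\mapsto\phi_a$, be a Drinfeld module of rank $2$: an $\mathbb{F}_q$-algebra morphism such that the coefficient of $\tau^0$ in $\phi_a$ is $\gamma(a)$ for all $a$, and $\deg_\tau(\phi_a)=2\deg(a)$ for all $a\neq 0$. For $K$ as above, let $\operatorname{End}_K(\phi)$ be the $\mathbb{F}_q$-algebra of all $\iota\in K\{\tau\}$ with $\iota\phi_a=\phi_a\iota$ for all $a\in\mathbb{F}_q[X]$, and let $\tau_L=\tau^{[L:\mathbb{F}_q]}\in\operatorname{End}_L(\phi)$.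 Let $\xi=Y^2+h(X)Y-f(X)\in\mathbb{F}_q[X][Y]$ be the characteristic polynomial of the Frobenius endomorphism $\tau_L$ of $\phi$, i.e. $\xi(\phi_X,\tau_L)=0$, $\deg f=[L:\mathbb{F}_q]$ and $\deg h\le[L:\mathbb{F}_q]/2$. Assume that $\phi$ is ordinary, i.e. $h\notin\mathfrak p$, and that $\xi$ defines an imaginary hyperelliptic curve, i.e. for some integer $g\ge 0$ one has $\deg f=2g+1$ and $\deg h\le g$, and the affine plane curve $\xi=0$ has no singular point over an algebraic closure of $\mathbb{F}_q$. Then $$\operatorname{End}_{\overline L}(\phi)=\operatorname{End}_L(\phi).$$ Moreover, writing $\mathbf{A}_{\mathcal H}=\mathbb{F}_q[X][Y]/(\xi)$, there is an isomorphism of $\mathbb{F}_q$-algebras $\mathbf{A}_{\mathcal H}\to\operatorname{End}_L(\phi)$ with $\overline X\mapsto\phi_X$ and $\overline Y\mapsto\tau_L$. -/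

import Mathlib

open Polynomial

noncomputable section

/-! Throughout, `F` is the finite field with `q` elements, `K` is an extension of `F`, and `Ω`
plays the role of an algebraic closure of `K`. -/

section Ore

variable (F : Type*) [Field F] [Fintype F]

/-- The Frobenius endomorphism `τ : x ↦ x ^ q` of `Ω`, as an `F`-linear map, `q = #F`. -/
def frobTau (Ω : Type*) [Field Ω] [Algebra F Ω] : Module.End F Ω :=
  (FiniteField.frobeniusAlgHom F Ω).toLinearMap

variable (K Ω : Type*) [Field K] [Field Ω] [Algebra F K] [Algebra F Ω] [Algebra K Ω]
  [IsScalarTower F K Ω]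

/-- The endomorphism `∑ aᵢ τ ^ i` of `Ω` attached to a finite family of coefficients in `K`. -/
def oreOfCoeffs (a : ℕ →₀ K) : Module.End F Ω :=
  a.sum fun i c => c • frobTau F Ω ^ i

@[simp]
theorem frobTau_pow_apply (i : ℕ) (x : Ω) :
    (frobTau F Ω ^ i) x = x ^ (Fintype.card F ^ i) := by
  induction i generalizing x with
  | zero => simp
  | succ n ih =>
    rw [pow_succ, Module.End.mul_apply, ih]
    simp [frobTau, pow_succ', pow_mul]

theorem oreOfCoeffs_single (i : ℕ) (c : K) :
    oreOfCoeffs F K Ω (Finsupp.single i c) = c • frobTau F Ω ^ i := by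
  simp [oreOfCoeffs]

theorem oreOfCoeffs_add (a b : ℕ →₀ K) :
    oreOfCoeffs F K Ω (a + b) = oreOfCoeffs F K Ω a + oreOfCoeffs F K Ω b :=
  Finsupp.sum_add_index' (by simp) (by intros; rw [add_smul])

theorem oreOfCoeffs_mul (a b : ℕ →₀ K) :
    ∃ c, oreOfCoeffs F K Ω a * oreOfCoeffs F K Ω b = oreOfCoeffs F K Ω c := by
  induction a using Finsupp.induction_linear with
  | zero => exact ⟨0, by simp [oreOfCoeffs]⟩
  | add a₁ a₂ h₁ h₂ =>
    obtain ⟨c₁, h₁⟩ := h₁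
    obtain ⟨c₂, h₂⟩ := h₂
    exact ⟨c₁ + c₂, by rw [oreOfCoeffs_add, oreOfCoeffs_add, add_mul, h₁, h₂]⟩
  | single i x =>
    induction b using Finsupp.induction_linear with
    | zero => exact ⟨0, by simp [oreOfCoeffs]⟩
    | add b₁ b₂ h₁ h₂ =>
      obtain ⟨c₁, h₁⟩ := h₁
      obtain ⟨c₂, h₂⟩ := h₂
      exact ⟨c₁ + c₂, by rw [oreOfCoeffs_add, oreOfCoeffs_add, mul_add, h₁, h₂]⟩
    | single j y =>
      refine ⟨Finsupp.single (i + j) (x * y ^ (Fintype.card F ^ i)), ?_⟩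
      ext z
      simp only [oreOfCoeffs_single, Module.End.mul_apply, LinearMap.smul_apply,
        frobTau_pow_apply, Algebra.smul_def, map_mul, map_pow, mul_pow, pow_add]
      ring

/-- The ring `K{τ}` of Ore polynomials: the subring of the `F`-linear endomorphisms of `Ω` of the
form `∑ aᵢ τ ^ i` with `aᵢ ∈ K`, under addition and composition. -/
def oreRing : Subalgebra F (Module.End F Ω) where
  carrier := {P | ∃ a : ℕ →₀ K, P = oreOfCoeffs F K Ω a}
  mul_mem' := by
    rintro _ _ ⟨a, rfl⟩ ⟨b, rfl⟩
    exact oreOfCoeffs_mul F K Ω a b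
  add_mem' := by
    rintro _ _ ⟨a, rfl⟩ ⟨b, rfl⟩
    exact ⟨a + b, (oreOfCoeffs_add F K Ω a b).symm⟩
  algebraMap_mem' r := by
    refine ⟨Finsupp.single 0 (algebraMap F K r), ?_⟩
    ext z
    simp [oreOfCoeffs_single, Module.algebraMap_end_apply]

variable {F K Ω}

/-- The coefficients of an Ore polynomial (see `oreCoeffs_eq` for their uniqueness). -/
def oreCoeffs (P : oreRing F K Ω) : ℕ →₀ K := P.2.choose

theorem oreOfCoeffs_oreCoeffs (P : oreRing F K Ω) :
    oreOfCoeffs F K Ω (oreCoeffs P) = P := P.2.choose_spec.symm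

theorem oreOfCoeffs_injective [Infinite Ω] : Function.Injective (oreOfCoeffs F K Ω) := by
  intro a b hab
  have hq : 1 < Fintype.card F := Fintype.one_lt_card
  let pol : (ℕ →₀ K) → Polynomial Ω := fun c =>
    c.sum fun i x => Polynomial.monomial (Fintype.card F ^ i) (algebraMap K Ω x)
  have hev : ∀ c z, (pol c).eval z = oreOfCoeffs F K Ω c z := by
    intro c z
    simp [pol, oreOfCoeffs, Finsupp.sum, Polynomial.eval_finsetSum, Algebra.smul_def]
  have hpol : pol a = pol b := Polynomial.funext fun z => by rw [hev, hev, hab]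
  have hcoeff : ∀ c i, (pol c).coeff (Fintype.card F ^ i) = algebraMap K Ω (c i) := by
    intro c i
    simp only [pol, Finsupp.sum, Polynomial.finsetSum_coeff, Polynomial.coeff_monomial,
      Nat.pow_right_inj hq]
    rw [Finset.sum_ite_eq' c.support i]
    by_cases hi : c i = 0 <;> simp [hi]
  ext i
  apply (algebraMap K Ω).injective
  rw [← hcoeff, ← hcoeff, hpol]

theorem oreCoeffs_eq [Infinite Ω] (P : oreRing F K Ω) (a : ℕ →₀ K)
    (h : (P : Module.End F Ω) = oreOfCoeffs F K Ω a) : oreCoeffs P = a :=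
  oreOfCoeffs_injective ((oreOfCoeffs_oreCoeffs P).trans h)

/-- The `τ`-degree of an Ore polynomial (with value `0` at `0`). -/
def tauDegree (P : oreRing F K Ω) : ℕ := (oreCoeffs P).support.sup id

end Ore

section Drinfeld

variable {F : Type*} [Field F] [Fintype F]
variable {K : Type*} [Field K] [Algebra F K]

/-- A Drinfeld `F[X]`-module over `K`, where `K` is equipped with the `F`-algebra morphism
`γ : F[X] → K`: an `F`-algebra morphism `φ : F[X] → K{τ}` such that the coefficient of `τ ^ 0` in
`φ a` is `γ a` for all `a`, and such that `φ a` has positive `τ`-degree for some `a`. -/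
structure DrinfeldModule (γ : F[X] →ₐ[F] K) (Ω : Type*) [Field Ω] [Algebra F Ω] [Algebra K Ω]
    [IsScalarTower F K Ω] where
  toAlgHom : F[X] →ₐ[F] oreRing F K Ω
  coeff_zero : ∀ a, oreCoeffs (toAlgHom a) 0 = γ a
  exists_pos : ∃ a, 0 < tauDegree (toAlgHom a)

namespace DrinfeldModule

variable {γ : F[X] →ₐ[F] K} {Ω : Type*} [Field Ω] [Algebra F Ω] [Algebra K Ω]
  [IsScalarTower F K Ω]

/-- `φ_a`, as an endomorphism of `Ω`. -/
def act (φ : DrinfeldModule γ Ω) (a : F[X]) : Module.End F Ω := φ.toAlgHom a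

/-- `φ` has rank `r`: `r > 0` and `deg_τ (φ_a) = r * deg a` for all nonzero `a`. -/
def HasRank (φ : DrinfeldModule γ Ω) (r : ℕ) : Prop :=
  0 < r ∧ ∀ a : F[X], a ≠ 0 → tauDegree (φ.toAlgHom a) = r * a.natDegree

/-- The ring `End_{K'}(φ)`, for a field `K'` with `K ⊆ K' ⊆ Ω`: all `ι ∈ K'{τ}` such that
`ι φ_a = φ_a ι` for all `a`. -/
def endRing (φ : DrinfeldModule γ Ω) (K' : Type*) [Field K'] [Algebra F K'] [Algebra K' Ω]
    [IsScalarTower F K' Ω] : Subalgebra F (Module.End F Ω) :=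
  oreRing F K' Ω ⊓ Subalgebra.centralizer F (Set.range φ.act)

theorem mem_endRing (φ : DrinfeldModule γ Ω) (K' : Type*) [Field K'] [Algebra F K']
    [Algebra K' Ω] [IsScalarTower F K' Ω] (ι : Module.End F Ω) :
    ι ∈ φ.endRing K' ↔ ι ∈ oreRing F K' Ω ∧ ∀ a, ι * φ.act a = φ.act a * ι := by
  simp [endRing, Algebra.mem_inf, Subalgebra.mem_centralizer_iff, eq_comm]

variable (F K Ω) in
/-- The Frobenius endomorphism `τ_K = τ ^ [K : F]`, for `K` finite over `F`. -/
def frobEnd : Module.End F Ω := frobTau F Ω ^ Module.finrank F K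

/-- The monic polynomial `Y ^ 2 + h(X) Y - f(X)` of `F[X][Y]`. -/
def quadPoly (h f : F[X]) : F[X][X] :=
  X ^ 2 + C h * X - C f

/-- `ξ = Y ^ 2 + h Y - f` is the characteristic polynomial of the Frobenius endomorphism of the
rank two Drinfeld module `φ` over the finite field `K`: `ξ(φ_X, τ_K) = 0`, `deg f = [K : F]` and
`deg h ≤ [K : F] / 2`. Here `h(φ_X) = φ_h` and `f(φ_X) = φ_f`. -/
def IsFrobCharPoly (φ : DrinfeldModule γ Ω) (h f : F[X]) : Prop :=
  frobEnd F K Ω ^ 2 + φ.act h * frobEnd F K Ω - φ.act f = 0 ∧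
    f.natDegree = Module.finrank F K ∧ 2 * h.natDegree ≤ Module.finrank F K

/-- `φ` is supersingular when the coefficient `h` of the characteristic polynomial
`Y ^ 2 + h Y - f` of its Frobenius endomorphism lies in `𝔭 = ker γ`. -/
def IsSupersingular (φ : DrinfeldModule γ Ω) : Prop :=
  ∃ h f : F[X], φ.IsFrobCharPoly h f ∧ h ∈ RingHom.ker γ

/-- `φ` is ordinary when it is not supersingular. -/
def IsOrdinary (φ : DrinfeldModule γ Ω) : Prop := ¬ φ.IsSupersingular

end DrinfeldModule

/-- `Y ^ 2 + h(X) Y - f(X)` defines an imaginary hyperelliptic curve over `F`: for some `g`,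
`deg f = 2 g + 1` and `deg h ≤ g`, and the affine plane curve has no singular point over an
algebraic closure of `F`. -/
def IsImaginaryHyperelliptic (h f : F[X]) : Prop :=
  (∃ g : ℕ, f.natDegree = 2 * g + 1 ∧ h.natDegree ≤ g) ∧
    ∀ x y : AlgebraicClosure F,
      y ^ 2 + aeval x h * y - aeval x f = 0 →
        ¬ (2 * y + aeval x h = 0 ∧ aeval x (derivative h) * y - aeval x (derivative f) = 0)

end Drinfeld

end

/-! Write q = #F and n = [L : F].

Descent to L. The coefficients of an endomorphism P over `Ω` generate a finite extension of L, so P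
commutes with some power τ_L^m, m > 0. Reducing modulo ξ gives τ_L^m = φ_a τ_L + φ_b, and since γ(f)
= 0 one finds γ(a) = (-γ(h))^(m-1), which is nonzero for ordinary φ. Hence φ_a ≠ 0 kills the
commutator of τ_L and P. Ore polynomials form a domain, so P commutes with τ_L, which forces its
coefficients into L (`endRing_eq_of_isOrdinary`).

The ring over L. Nonzero φ_s have even τ-degree and nonzero φ_t τ_L odd τ-degree, so 1 and τ_L are
independent over F[X]. By the same parity, an endomorphism of τ-degree at least n has the τ-degree
of some φ_(X^k) or φ_(X^k) τ_L. The ratio of leading coefficients is fixed by x ↦ x^(q^2), hence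
lies in F as n is odd, so the τ-degree can be lowered (`exists_eq_add_mul_add`). Only finitely many
remainders occur. Thus F[X][τ_L] has finite index in the endomorphism ring, which is therefore
commutative, integral over F[X], and torsion modulo F[X][τ_L]. The coordinate ring of a smooth
affine curve is normal, so the two rings coincide (`exists_eq_add_mul_of_mul`). -/

set_option linter.unusedSectionVars false

noncomputable section

/-! ### Normality of the coordinate ring of a smooth plane curve -/

section Normality

variable {F : Type*} [Field F]

/-- At a smooth affine plane curve `y ^ 2 + h y - f = 0`, a prime `p` such that the trace of
`s + t y` is divisible by `p` and its norm by `p ^ 2` divides `s` and `t`. -/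
theorem dvd_and_dvd_of_dvd_trace_of_sq_dvd_norm {h f s t p : F[X]} (hp : Irreducible p)
    (hsm : ∀ x y : AlgebraicClosure F, y ^ 2 + aeval x h * y - aeval x f = 0 →
      ¬ (2 * y + aeval x h = 0 ∧ aeval x (derivative h) * y - aeval x (derivative f) = 0))
    (htr : p ∣ 2 * s - t * h) (hno : p ^ 2 ∣ s ^ 2 - s * t * h - t ^ 2 * f) :
    p ∣ s ∧ p ∣ t := by
  have hpp : Prime p := hp.prime
  by_cases hpt : p ∣ t
  · refine ⟨?_, hpt⟩
    have h1 : p ∣ s ^ 2 - s * t * h - t ^ 2 * f := (dvd_pow_self p two_ne_zero).trans hno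
    have h2 : p ∣ s ^ 2 := by
      have : s ^ 2 = (s ^ 2 - s * t * h - t ^ 2 * f) + t * (s * h + t * f) := by ring
      rw [this]
      exact dvd_add h1 (hpt.mul_right _)
    exact hpp.dvd_of_dvd_pow h2
  exfalso
  -- With u inverse to t modulo p^2, the norm of s + t y is t^2 ξ(-s/t), so y₀ = -(u s) is a root of
  -- ξ modulo p^2; the trace condition makes it a double root modulo p.
  have hco : IsCoprime (p ^ 2) t := ((hp.coprime_iff_not_dvd).2 hpt).pow_left
  obtain ⟨v, u, huv⟩ := hco
  obtain ⟨r, hr⟩ : p ^ 2 ∣ (-(u * s)) ^ 2 + h * (-(u * s)) - f := by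
    refine (IsCoprime.pow_right (n := 2) ⟨v, u, huv⟩ : IsCoprime (p ^ 2) (t ^ 2)).dvd_of_dvd_mul_left ?_
    have : t ^ 2 * ((-(u * s)) ^ 2 + h * (-(u * s)) - f) =
        (s ^ 2 - s * t * h - t ^ 2 * f) +
          p ^ 2 * (v * (s * t * h) - v * (1 + u * t) * s ^ 2) := by
      linear_combination (-(s * t * h) + s ^ 2 * (1 + u * t)) * huv
    rw [this]
    exact dvd_add hno (dvd_mul_right _ _)
  have htr' : p ∣ 2 * (-(u * s)) + h := by
    refine (hpp.dvd_or_dvd (a := t) ?_).resolve_left hpt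
    have : t * (2 * (-(u * s)) + h) = p * (2 * p * v * s) - (2 * s - t * h) := by
      linear_combination (-2 * s) * huv
    rw [this]
    exact dvd_sub (dvd_mul_right _ _) htr
  obtain ⟨x, hx⟩ := IsAlgClosed.exists_aeval_eq_zero (AlgebraicClosure F) p
    (degree_pos_of_irreducible hp).ne'
  have h1 := congrArg (aeval x) hr
  -- As p^2 divides ξ(X, y₀(X)), its derivative ξ_X + ξ_Y y₀' also vanishes at the root x of p.
  -- Since ξ_Y = 0 there, so is ξ_X, and (x, y₀(x)) is singular.
  have h2 := congrArg (aeval x) (congrArg derivative hr)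
  obtain ⟨w, hw⟩ := htr'
  have h3 := congrArg (aeval x) hw
  simp only [map_sub, map_add, map_mul, map_neg, map_pow, hx, derivative_mul, derivative_pow,
    Nat.cast_ofNat, map_ofNat] at h1 h2 h3
  refine hsm x (aeval x (-(u * s))) ?_ ⟨?_, ?_⟩
  · simp only [map_neg, map_mul]
    linear_combination h1
  · simp only [map_neg, map_mul]
    linear_combination h3
  · simp only [map_neg, map_mul]
    simp at h2
    linear_combination h2 + h3 * (aeval x (derivative u) * aeval x s + aeval x u * aeval x (derivative s))

variable {S : Type*} [CommRing S] [IsDomain S] [Algebra F[X] S]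

/-- The element z = (s + t y) / p is a root of p^2 Z^2 - p Tr(s + t y) Z + N(s + t y). Its minimal
polynomial over the integrally closed ring F[X] divides this, so either z lies in F[X] or p divides
the trace and p^2 the norm. -/
theorem exists_eq_add_mul_of_irreducible_mul {h f : F[X]}
    (hsm : ∀ x y : AlgebraicClosure F, y ^ 2 + aeval x h * y - aeval x f = 0 →
      ¬ (2 * y + aeval x h = 0 ∧ aeval x (derivative h) * y - aeval x (derivative f) = 0))
    {y : S} (hy : y ^ 2 + algebraMap F[X] S h * y - algebraMap F[X] S f = 0)
    (hind : ∀ s t : F[X], algebraMap F[X] S s + algebraMap F[X] S t * y = 0 → s = 0 ∧ t = 0)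
    {z : S} (hz : IsIntegral F[X] z) {p s t : F[X]} (hp : Irreducible p)
    (hpz : algebraMap F[X] S p * z = algebraMap F[X] S s + algebraMap F[X] S t * y) :
    ∃ s' t' : F[X], z = algebraMap F[X] S s' + algebraMap F[X] S t' * y := by
  have hinj : Function.Injective (algebraMap F[X] S) := by
    rw [injective_iff_map_eq_zero]
    intro a ha
    exact (hind a 0 (by simp [ha])).1
  have : FaithfulSMul F[X] S := (faithfulSMul_iff_algebraMap_injective _ _).2 hinj
  have : Module.IsTorsionFree F[X] S := inferInstance
  have hp0 : algebraMap F[X] S p ≠ 0 := by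
    rw [Ne, map_eq_zero_iff _ hinj]
    exact hp.ne_zero
  have hone : ∀ s₁ t₁ : F[X], s = p * s₁ → t = p * t₁ →
      ∃ s' t' : F[X], z = algebraMap F[X] S s' + algebraMap F[X] S t' * y := by
    rintro s₁ t₁ rfl rfl
    refine ⟨s₁, t₁, mul_left_cancel₀ hp0 ?_⟩
    rw [hpz, map_mul, map_mul]
    ring
  let Q : F[X][X] := C (p ^ 2) * X ^ 2 + C (-(p * (2 * s - t * h))) * X +
    C (s ^ 2 - s * t * h - t ^ 2 * f)
  have hQ : aeval z Q = 0 := by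
    simp only [Q, map_add, map_mul, aeval_C, aeval_X, map_pow, map_sub, map_neg, map_ofNat]
    linear_combination (algebraMap F[X] S p * z + algebraMap F[X] S s + algebraMap F[X] S t * y
      - (2 * algebraMap F[X] S s - algebraMap F[X] S t * algebraMap F[X] S h)) * hpz
      + algebraMap F[X] S t ^ 2 * hy
  obtain ⟨R, hR⟩ := minpoly.isIntegrallyClosed_dvd hz hQ
  have hmon := minpoly.monic hz
  have hp2 : p ^ 2 ≠ 0 := pow_ne_zero _ hp.ne_zero
  have hQdeg : Q.natDegree = 2 := natDegree_quadratic hp2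
  have hQ0 : Q ≠ 0 := by
    intro h0
    simp [h0] at hQdeg
  have hR0 : R ≠ 0 := by
    rintro rfl
    exact hQ0 (by simpa using hR)
  have hdeg : (minpoly F[X] z).natDegree + R.natDegree = 2 := by
    rw [← hQdeg, hR, hmon.natDegree_mul' hR0]
  have hpos := minpoly.natDegree_pos hz
  obtain h1 | h2 : (minpoly F[X] z).natDegree = 1 ∨ (minpoly F[X] z).natDegree = 2 := by omega
  · obtain ⟨b, rfl⟩ := minpoly.mem_range_of_degree_eq_one F[X] z
      (degree_eq_iff_natDegree_eq_of_pos one_pos |>.2 h1)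
    exact ⟨b, 0, by simp⟩
  -- The cofactor is a constant, and comparing coefficients of degree 2 it is p^2.
  · obtain ⟨c, rfl⟩ := natDegree_eq_zero.1 (show R.natDegree = 0 by omega)
    have hc2 := congrArg (coeff · 2) hR
    have hc1 := congrArg (coeff · 1) hR
    have hc0 := congrArg (coeff · 0) hR
    have hl : (minpoly F[X] z).coeff 2 = 1 := by
      rw [← h2]
      exact hmon
    simp only [coeff_mul_C, hl, one_mul, Q, coeff_add, coeff_C_mul, coeff_X_pow, coeff_X,
      coeff_C] at hc2 hc1 hc0
    norm_num at hc2 hc1 hc0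
    subst hc2
    obtain ⟨⟨s₁, hs⟩, ⟨t₁, ht⟩⟩ := dvd_and_dvd_of_dvd_trace_of_sq_dvd_norm hp hsm
      (s := s) (t := t) ⟨-(minpoly F[X] z).coeff 1, mul_left_cancel₀ hp.ne_zero
        (by linear_combination -hc1)⟩ ⟨(minpoly F[X] z).coeff 0, by rw [hc0, mul_comm]⟩
    exact hone s₁ t₁ hs ht

/-- The ring `F[X][y]` of a smooth affine plane curve `y ^ 2 + h y - f = 0` is integrally closed
in any integral extension in which it has torsion cokernel. -/
theorem exists_eq_add_mul_of_mul [Algebra.IsIntegral F[X] S] {h f : F[X]}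
    (hsm : ∀ x y : AlgebraicClosure F, y ^ 2 + aeval x h * y - aeval x f = 0 →
      ¬ (2 * y + aeval x h = 0 ∧ aeval x (derivative h) * y - aeval x (derivative f) = 0))
    {y : S} (hy : y ^ 2 + algebraMap F[X] S h * y - algebraMap F[X] S f = 0)
    (hind : ∀ s t : F[X], algebraMap F[X] S s + algebraMap F[X] S t * y = 0 → s = 0 ∧ t = 0)
    {a : F[X]} (ha : a ≠ 0) (z : S)
    (haz : ∃ s t : F[X],
      algebraMap F[X] S a * z = algebraMap F[X] S s + algebraMap F[X] S t * y) :
    ∃ s t : F[X], z = algebraMap F[X] S s + algebraMap F[X] S t * y := by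
  induction a using WfDvdMonoid.induction_on_irreducible generalizing z with
  | zero => exact absurd rfl ha
  | unit u hu =>
    obtain ⟨s, t, hst⟩ := haz
    obtain ⟨v, hv⟩ := hu.exists_left_inv
    refine ⟨v * s, v * t, ?_⟩
    have h1 : algebraMap F[X] S v * algebraMap F[X] S u = 1 := by rw [← map_mul, hv, map_one]
    rw [map_mul, map_mul]
    linear_combination algebraMap F[X] S v * hst - z * h1
  | mul a p ha0 hp ih =>
    refine ih ha0 z ?_
    obtain ⟨s, t, hst⟩ := haz
    exact exists_eq_add_mul_of_irreducible_mul hsm hy hind (Algebra.IsIntegral.isIntegral _) hp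
      (s := s) (t := t) (by rw [← hst, map_mul, mul_assoc])

end Normality

/-! ### Fixed points of powers of Frobenius -/

section FixedField

/-- The polynomial X^#k - X already splits over k, so an extension adds no roots. -/
theorem exists_algebraMap_eq_of_pow_card_eq {k M : Type*} [Field k] [Fintype k] [Field M]
    [Algebra k M] {x : M} (hx : x ^ Fintype.card k = x) : ∃ v : k, algebraMap k M v = x := by
  have hq : 1 < Fintype.card k := Fintype.one_lt_card
  have hne : (X ^ Fintype.card k - X : k[X]) ≠ 0 := FiniteField.X_pow_card_sub_X_ne_zero k hq
  have hs : (X ^ Fintype.card k - X : k[X]).Splits := by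
    rw [splits_iff_card_roots, FiniteField.roots_X_pow_card_sub_X,
      FiniteField.X_pow_card_sub_X_natDegree_eq k hq]
    rfl
  have hmem : x ∈ ((X ^ Fintype.card k - X : k[X]).map (algebraMap k M)).roots := by
    rw [mem_roots (map_ne_zero hne)]
    simp [hx]
  rw [hs.roots_map, FiniteField.roots_X_pow_card_sub_X, Multiset.mem_map] at hmem
  obtain ⟨v, -, hv⟩ := hmem
  exact ⟨v, hv⟩

theorem pow_pow_mul_eq_self {M : Type*} [Monoid M] {x : M} {Q m : ℕ} (hx : x ^ Q ^ m = x) (k : ℕ) :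
    x ^ Q ^ (m * k) = x := by
  induction k with
  | zero => simp
  | succ k ih => rw [Nat.mul_succ, pow_add, pow_mul, ih, hx]

theorem exists_pow_pow_card_eq (k : Type*) {M : Type*} [Field k] [Fintype k] [Field M]
    [Algebra k M] [Algebra.IsAlgebraic k M] (x : M) :
    ∃ m, 0 < m ∧ x ^ Fintype.card k ^ m = x := by
  have hfin : FiniteDimensional k (IntermediateField.adjoin k {x}) :=
    IntermediateField.adjoin.finiteDimensional (Algebra.IsIntegral.isIntegral x)
  have hfin' : Finite (IntermediateField.adjoin k {x}) := Module.finite_of_finite k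
  have := Fintype.ofFinite (IntermediateField.adjoin k {x})
  refine ⟨Module.finrank k (IntermediateField.adjoin k {x}), Module.finrank_pos, ?_⟩
  have h := FiniteField.pow_card (⟨x, IntermediateField.mem_adjoin_simple_self k x⟩ :
    IntermediateField.adjoin k {x})
  rw [Module.card_eq_pow_finrank (K := k)] at h
  exact congrArg Subtype.val h

theorem exists_forall_pow_pow_card_eq (k : Type*) {M : Type*} [Field k] [Fintype k] [Field M]
    [Algebra k M] [Algebra.IsAlgebraic k M] (s : Finset M) :
    ∃ m, 0 < m ∧ ∀ x ∈ s, x ^ Fintype.card k ^ m = x := by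
  classical
  choose m hm hx using exists_pow_pow_card_eq k (M := M)
  refine ⟨∏ x ∈ s, m x, Finset.prod_pos fun x _ => hm x, fun x hxs => ?_⟩
  rw [← Finset.mul_prod_erase s m hxs]
  exact pow_pow_mul_eq_self (hx x) _

end FixedField

/-! ### Ore polynomials as linearized polynomials under composition -/

section OrePolynomial

variable {F : Type*} [Field F] [Fintype F]
variable {K Ω : Type*} [Field K] [Field Ω] [Algebra F K] [Algebra F Ω] [Algebra K Ω]
  [IsScalarTower F K Ω]

/-- The linearized polynomial `∑ aᵢ X ^ (q ^ i)` attached to the Ore polynomial `∑ aᵢ τ ^ i`. -/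
def orePoly (P : oreRing F K Ω) : K[X] :=
  (oreCoeffs P).sum fun i c => monomial (Fintype.card F ^ i) c

theorem aeval_orePoly (P : oreRing F K Ω) (z : Ω) :
    aeval z (orePoly P) = (P : Module.End F Ω) z := by
  rw [← oreOfCoeffs_oreCoeffs P]
  simp only [orePoly, oreOfCoeffs, Finsupp.sum, map_sum, aeval_monomial, LinearMap.sum_apply,
    LinearMap.smul_apply, frobTau_pow_apply, Algebra.smul_def]

theorem coeff_orePoly_pow (P : oreRing F K Ω) (i : ℕ) :
    (orePoly P).coeff (Fintype.card F ^ i) = oreCoeffs P i := by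
  have hq : 1 < Fintype.card F := Fintype.one_lt_card
  simp only [orePoly, Finsupp.sum, finsetSum_coeff, coeff_monomial, Nat.pow_right_inj hq]
  rw [Finset.sum_ite_eq' (oreCoeffs P).support i]
  by_cases hi : oreCoeffs P i = 0 <;> simp [hi]

theorem natDegree_orePoly_le (P : oreRing F K Ω) :
    (orePoly P).natDegree ≤ Fintype.card F ^ tauDegree P := by
  refine natDegree_sum_le_of_forall_le _ _ fun i hi => (natDegree_monomial_le _).trans ?_
  exact Nat.pow_le_pow_right Fintype.card_pos (Finset.le_sup (f := id) hi)

theorem coeff_zero_orePoly (P : oreRing F K Ω) : (orePoly P).coeff 0 = 0 := by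
  have hq : Fintype.card F ≠ 0 := Fintype.card_ne_zero
  simp only [orePoly, Finsupp.sum, finsetSum_coeff, coeff_monomial, pow_eq_zero_iff', hq,
    false_and, if_false, Finset.sum_const_zero]

theorem natDegree_orePoly {P : oreRing F K Ω} (hP : P ≠ 0) :
    (orePoly P).natDegree = Fintype.card F ^ tauDegree P := by
  refine le_antisymm (natDegree_orePoly_le P) (le_natDegree_of_ne_zero ?_)
  rw [coeff_orePoly_pow]
  have hs : (oreCoeffs P).support.Nonempty := by
    rw [Finsupp.support_nonempty_iff]
    intro h0
    refine hP (Subtype.ext ?_)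
    rw [← oreOfCoeffs_oreCoeffs P, h0]
    simp [oreOfCoeffs]
  obtain ⟨i, hi, hi'⟩ := Finset.exists_mem_eq_sup _ hs id
  rw [tauDegree, hi']
  exact Finsupp.mem_support_iff.1 hi

theorem tauDegree_eq_of_natDegree {P : oreRing F K Ω} (hP : P ≠ 0) {d : ℕ}
    (h : (orePoly P).natDegree = Fintype.card F ^ d) : tauDegree P = d := by
  rw [natDegree_orePoly hP] at h
  exact Nat.pow_right_injective Fintype.one_lt_card h

theorem natDegree_orePoly_ne_zero {P : oreRing F K Ω} (hP : P ≠ 0) :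
    (orePoly P).natDegree ≠ 0 := by
  rw [natDegree_orePoly hP]
  exact pow_ne_zero _ Fintype.card_ne_zero

section Infinite

variable [Infinite Ω]

theorem eq_of_forall_aeval_eq {p r : K[X]} (h : ∀ z : Ω, aeval z p = aeval z r) : p = r := by
  apply map_injective (algebraMap K Ω) (algebraMap K Ω).injective
  refine Polynomial.funext fun z => ?_
  simpa only [eval_map_algebraMap] using h z

theorem orePoly_eq {P : oreRing F K Ω} {p : K[X]}
    (h : ∀ z : Ω, aeval z p = (P : Module.End F Ω) z) : orePoly P = p :=
  eq_of_forall_aeval_eq fun z => by rw [aeval_orePoly, h z]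

theorem orePoly_mul (P R : oreRing F K Ω) : orePoly (P * R) = (orePoly P).comp (orePoly R) :=
  orePoly_eq fun z => by simp [aeval_comp, aeval_orePoly]

theorem orePoly_sub (P R : oreRing F K Ω) : orePoly (P - R) = orePoly P - orePoly R :=
  orePoly_eq fun z => by simp [aeval_orePoly]

theorem orePoly_smul (v : F) (P : oreRing F K Ω) :
    orePoly (v • P) = C (algebraMap F K v) * orePoly P :=
  orePoly_eq fun z => by
    simp [aeval_orePoly, Algebra.smul_def, ← IsScalarTower.algebraMap_apply F K Ω]

@[simp]
theorem orePoly_zero : orePoly (0 : oreRing F K Ω) = 0 :=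
  orePoly_eq fun z => by simp

theorem orePoly_eq_zero_iff {P : oreRing F K Ω} : orePoly P = 0 ↔ P = 0 := by
  refine ⟨fun h => Subtype.ext (LinearMap.ext fun z => ?_), fun h => h ▸ orePoly_zero⟩
  rw [← aeval_orePoly, h]
  simp

@[simp]
theorem tauDegree_zero : tauDegree (0 : oreRing F K Ω) = 0 := by
  have : oreCoeffs (0 : oreRing F K Ω) = 0 := oreCoeffs_eq _ _ (by simp [oreOfCoeffs])
  simp [tauDegree, this]

instance : NoZeroDivisors (oreRing F K Ω) where
  eq_zero_or_eq_zero_of_mul_eq_zero := by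
    intro P R h
    have h0 : (orePoly P).comp (orePoly R) = 0 := by rw [← orePoly_mul, h, orePoly_zero]
    -- In the second case the inner polynomial is constant, hence zero, as linearized polynomials
    -- have no constant term.
    rcases comp_eq_zero_iff.1 h0 with h1 | ⟨-, h1⟩
    · exact Or.inl (orePoly_eq_zero_iff.1 h1)
    · rw [coeff_zero_orePoly, C_0] at h1
      exact Or.inr (orePoly_eq_zero_iff.1 h1)

theorem tauDegree_mul {P R : oreRing F K Ω} (hP : P ≠ 0) (hR : R ≠ 0) :
    tauDegree (P * R) = tauDegree P + tauDegree R := by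
  refine tauDegree_eq_of_natDegree (mul_ne_zero hP hR) ?_
  rw [orePoly_mul, natDegree_comp, natDegree_orePoly hP, natDegree_orePoly hR, pow_add]

theorem tauDegree_smul {v : F} (hv : v ≠ 0) (P : oreRing F K Ω) :
    tauDegree (v • P) = tauDegree P := by
  by_cases hP : P = 0
  · simp [hP]
  refine tauDegree_eq_of_natDegree (smul_ne_zero hv hP) ?_
  rw [orePoly_smul, natDegree_C_mul (by simpa using hv), natDegree_orePoly hP]

/-- Cancelling leading coefficients lowers the `τ`-degree. -/
theorem tauDegree_sub_lt {P R : oreRing F K Ω} (hP : P ≠ 0) (hR : R ≠ 0)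
    (hdeg : tauDegree P = tauDegree R) (hpos : 0 < tauDegree P)
    (hlead : (orePoly P).leadingCoeff = (orePoly R).leadingCoeff) :
    tauDegree (P - R) < tauDegree P := by
  -- Zero has `tauDegree` 0, so this case needs `hpos`.
  by_cases h0 : P - R = 0
  · simpa [h0] using hpos
  have hP' : orePoly P ≠ 0 := mt orePoly_eq_zero_iff.1 hP
  have hR' : orePoly R ≠ 0 := mt orePoly_eq_zero_iff.1 hR
  have h1 : (orePoly P - orePoly R).degree < (orePoly P).degree := by
    refine degree_sub_lt_left ?_ hP' hlead
    rw [degree_eq_natDegree hP', degree_eq_natDegree hR', natDegree_orePoly hP,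
      natDegree_orePoly hR, hdeg]
  have h2 := natDegree_lt_natDegree (by rwa [← orePoly_sub, Ne, orePoly_eq_zero_iff]) h1
  rw [← orePoly_sub, natDegree_orePoly h0, natDegree_orePoly hP] at h2
  exact (Nat.pow_lt_pow_iff_right Fintype.one_lt_card).1 h2

/-- If `P` and `R` have the same `τ`-degree and commute with `D` of `τ`-degree `e`, then the
quotient of their leading coefficients is fixed by `x ↦ x ^ (q ^ e)`. -/
theorem leadingCoeff_div_pow_eq {P R D : oreRing F K Ω} (hP : P ≠ 0) (hR : R ≠ 0) (hD : D ≠ 0)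
    (hdeg : tauDegree P = tauDegree R) (hPD : P * D = D * P) (hRD : R * D = D * R) :
    ((orePoly P).leadingCoeff / (orePoly R).leadingCoeff) ^ Fintype.card F ^ tauDegree D =
      (orePoly P).leadingCoeff / (orePoly R).leadingCoeff := by
  -- Compare the leading coefficients of the compositions S ∘ D and D ∘ S.
  have key : ∀ S : oreRing F K Ω, S ≠ 0 → S * D = D * S →
      (orePoly S).leadingCoeff * (orePoly D).leadingCoeff ^ Fintype.card F ^ tauDegree S =
      (orePoly D).leadingCoeff * (orePoly S).leadingCoeff ^ Fintype.card F ^ tauDegree D := by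
    intro S hS h
    rw [← natDegree_orePoly hS, ← natDegree_orePoly hD,
      ← leadingCoeff_comp (natDegree_orePoly_ne_zero hD),
      ← leadingCoeff_comp (natDegree_orePoly_ne_zero hS), ← orePoly_mul, ← orePoly_mul, h]
  have h1 := key P hP hPD
  have h2 := key R hR hRD
  have hP' : (orePoly P).leadingCoeff ≠ 0 := leadingCoeff_ne_zero.2 (mt orePoly_eq_zero_iff.1 hP)
  have hR' : (orePoly R).leadingCoeff ≠ 0 := leadingCoeff_ne_zero.2 (mt orePoly_eq_zero_iff.1 hR)
  have hD' : (orePoly D).leadingCoeff ≠ 0 := leadingCoeff_ne_zero.2 (mt orePoly_eq_zero_iff.1 hD)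
  rw [hdeg] at h1
  rw [div_pow, div_eq_div_iff (pow_ne_zero _ hR') hR']
  refine mul_left_cancel₀ (mul_ne_zero hD' (pow_ne_zero (Fintype.card F ^ tauDegree R) hD')) ?_
  linear_combination (-(orePoly D).leadingCoeff ^ Fintype.card F ^ tauDegree R *
    (orePoly R).leadingCoeff) * h1 + (orePoly D).leadingCoeff ^ Fintype.card F ^ tauDegree R *
    (orePoly P).leadingCoeff * h2

end Infinite

theorem finite_setOf_tauDegree_lt [Finite K] (n : ℕ) :
    {P : oreRing F K Ω | tauDegree P < n}.Finite := by
  refine Set.Finite.of_injOn (f := fun P (i : Fin n) => oreCoeffs P i) (t := Set.univ)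
    (fun _ _ => Set.mem_univ _) ?_ Set.finite_univ
  intro P hP R hR h
  have hz : ∀ S : oreRing F K Ω, tauDegree S < n → ∀ i, n ≤ i → oreCoeffs S i = 0 := by
    intro S hS i hi
    by_contra h0
    have := Finset.le_sup (f := id) (Finsupp.mem_support_iff.2 h0)
    exact absurd (lt_of_le_of_lt this hS) (not_lt.2 hi)
  have : oreCoeffs P = oreCoeffs R := by
    ext i
    by_cases hi : i < n
    · exact congrFun h ⟨i, hi⟩
    · rw [hz P hP i (not_lt.1 hi), hz R hR i (not_lt.1 hi)]
  exact Subtype.ext (by rw [← oreOfCoeffs_oreCoeffs P, this, oreOfCoeffs_oreCoeffs])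

/-- The rule τ^k c = c^(q^k) τ^k, which turns commutation with a power of Frobenius into a condition
on coefficients. -/
theorem frobTau_pow_mul_oreOfCoeffs (k : ℕ) (a : ℕ →₀ K) :
    frobTau F Ω ^ k * oreOfCoeffs F K Ω a =
      oreOfCoeffs F K Ω (a.mapRange (· ^ Fintype.card F ^ k)
        (zero_pow (pow_ne_zero _ Fintype.card_ne_zero))) * frobTau F Ω ^ k := by
  induction a using Finsupp.induction_linear with
  | zero => simp [oreOfCoeffs]
  | add a b ha hb =>
    have hadd : ∀ x y : K, (x + y) ^ Fintype.card F ^ k =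
        x ^ Fintype.card F ^ k + y ^ Fintype.card F ^ k := fun x y => by
      simpa only [frobTau_pow_apply] using map_add (frobTau F K ^ k) x y
    rw [oreOfCoeffs_add, mul_add, ha, hb, ← add_mul, ← oreOfCoeffs_add]
    congr 2
    ext i
    simp [hadd]
  | single i c =>
    ext z
    simp only [oreOfCoeffs_single, Finsupp.mapRange_single, Module.End.mul_apply,
      LinearMap.smul_apply, frobTau_pow_apply, Algebra.smul_def, map_pow, mul_pow]
    rw [← pow_mul, ← pow_mul, mul_comm (Fintype.card F ^ i)]

theorem oreRing_mono : oreRing F K Ω ≤ oreRing F Ω Ω := by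
  rintro _ ⟨a, rfl⟩
  refine ⟨a.mapRange (algebraMap K Ω) (map_zero _), ?_⟩
  rw [oreOfCoeffs, oreOfCoeffs, Finsupp.sum_mapRange_index (by simp)]
  simp [algebraMap_smul]

theorem frobTau_pow_mem (i : ℕ) : frobTau F Ω ^ i ∈ oreRing F K Ω :=
  ⟨Finsupp.single i 1, by rw [oreOfCoeffs_single, one_smul]⟩

/-- Makes cancellation available in `Module.End F Ω`, for elements of the subring of Ore
polynomials. -/
theorem mul_eq_zero_of_mem_oreRing [Infinite Ω] {P R : Module.End F Ω} (hP : P ∈ oreRing F K Ω)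
    (hR : R ∈ oreRing F K Ω) (h : P * R = 0) : P = 0 ∨ R = 0 := by
  have := mul_eq_zero.1 (show (⟨P, hP⟩ : oreRing F K Ω) * ⟨R, hR⟩ = 0 from Subtype.ext h)
  simpa [Subtype.ext_iff] using this

end OrePolynomial

namespace DrinfeldModule

/-! ### Commutation with Frobenius and fields of definition -/

section Frobenius

variable {F : Type*} [Field F] [Fintype F]
variable {L : Type*} [Field L] [Algebra F L] [FiniteDimensional F L]
variable {Ω : Type*} [Field Ω] [Algebra F Ω] [Algebra L Ω] [IsScalarTower F L Ω]

variable (F L Ω) in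
theorem frobEnd_mem : frobEnd F L Ω ∈ oreRing F L Ω := frobTau_pow_mem _

theorem pow_card_pow_finrank (x : L) : x ^ Fintype.card F ^ Module.finrank F L = x := by
  have : Finite L := Module.finite_of_finite F
  have := Fintype.ofFinite L
  rw [← Module.card_eq_pow_finrank, FiniteField.pow_card]

theorem frobEnd_mul_comm {P : Module.End F Ω} (hP : P ∈ oreRing F L Ω) :
    frobEnd F L Ω * P = P * frobEnd F L Ω := by
  obtain ⟨a, rfl⟩ := hP
  rw [frobEnd, frobTau_pow_mul_oreOfCoeffs]
  congr 2
  ext i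
  simp [pow_card_pow_finrank]

/-- Moving τ_L across P raises the coefficients to the power #L; cancelling τ_L on the right shows
that they are fixed, hence in L. -/
theorem mem_oreRing_of_frobEnd_mul_comm [Infinite Ω] {P : Module.End F Ω}
    (hP : P ∈ oreRing F Ω Ω) (h : frobEnd F L Ω * P = P * frobEnd F L Ω) :
    P ∈ oreRing F L Ω := by
  have : Finite L := Module.finite_of_finite F
  have := Fintype.ofFinite L
  obtain ⟨a, rfl⟩ := hP
  have h0 := frobTau_pow_mul_oreOfCoeffs (F := F) (Ω := Ω) (Module.finrank F L) a
  set b := a.mapRange (· ^ Fintype.card F ^ Module.finrank F L)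
    (zero_pow (pow_ne_zero _ Fintype.card_ne_zero)) with hb
  have hF : frobTau F Ω ^ Module.finrank F L ≠ 0 := by
    intro h1
    have := LinearMap.congr_fun h1 1
    simp at this
  rw [frobEnd, h0, ← sub_eq_zero, ← sub_mul] at h
  have hab : oreOfCoeffs F Ω Ω b = oreOfCoeffs F Ω Ω a :=
    sub_eq_zero.1 ((mul_eq_zero_of_mem_oreRing (K := Ω) (sub_mem ⟨b, rfl⟩ ⟨a, rfl⟩)
      (frobTau_pow_mem (K := Ω) _) h).resolve_right hF)
  have hba : b = a := oreOfCoeffs_injective hab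
  have hfix : ∀ i, ∃ v : L, algebraMap L Ω v = a i := fun i => by
    apply exists_algebraMap_eq_of_pow_card_eq
    have := DFunLike.congr_fun hba i
    rwa [hb, Finsupp.mapRange_apply, ← Module.card_eq_pow_finrank (K := F) (V := L)] at this
  choose v hv using hfix
  rw [oreOfCoeffs, Finsupp.sum]
  refine sum_mem fun i _ => ⟨Finsupp.single i (v i), ?_⟩
  rw [oreOfCoeffs_single, ← hv, algebraMap_smul]

/-- The finitely many coefficients are algebraic over the finite field L, so one power of x ↦ x^#L
fixes them all. -/
theorem exists_frobEnd_pow_mul_comm [Algebra.IsAlgebraic L Ω] {P : Module.End F Ω}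
    (hP : P ∈ oreRing F Ω Ω) :
    ∃ m, 0 < m ∧ frobEnd F L Ω ^ m * P = P * frobEnd F L Ω ^ m := by
  classical
  have : Finite L := Module.finite_of_finite F
  have := Fintype.ofFinite L
  obtain ⟨a, rfl⟩ := hP
  obtain ⟨m, hm, h⟩ := exists_forall_pow_pow_card_eq L (a.support.image a)
  refine ⟨m, hm, ?_⟩
  rw [frobEnd, ← pow_mul, frobTau_pow_mul_oreOfCoeffs]
  congr 2
  ext i
  rw [Finsupp.mapRange_apply, pow_mul, ← Module.card_eq_pow_finrank (K := F) (V := L)]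
  by_cases hi : a i = 0
  · simp [hi]
  · exact h _ (Finset.mem_image_of_mem a (Finsupp.mem_support_iff.2 hi))

end Frobenius

/-! ### Ordinary modules: endomorphisms descend to L -/

section Act

variable {F : Type*} [Field F] [Fintype F]
variable {L : Type*} [Field L] [Algebra F L]
variable {Ω : Type*} [Field Ω] [Algebra F Ω] [Algebra L Ω] [IsScalarTower F L Ω]
variable {γ : F[X] →ₐ[F] L} (φ : DrinfeldModule γ Ω)

theorem act_mem (a : F[X]) : φ.act a ∈ oreRing F L Ω := (φ.toAlgHom a).2

theorem act_sub (a b : F[X]) : φ.act (a - b) = φ.act a - φ.act b := by simp [act]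

theorem act_mul (a b : F[X]) : φ.act (a * b) = φ.act a * φ.act b := by simp [act]

theorem act_zero : φ.act 0 = 0 := by simp [act]

theorem act_one : φ.act 1 = 1 := by simp [act]

theorem act_mul_comm (a b : F[X]) : φ.act a * φ.act b = φ.act b * φ.act a := by
  rw [← act_mul, mul_comm, act_mul]

variable {φ}

theorem act_eq_zero_imp [Infinite Ω] {a : F[X]} (h : φ.act a = 0) : γ a = 0 := by
  have h0 : φ.toAlgHom a = 0 := Subtype.ext h
  rw [← φ.coeff_zero, h0, ← coeff_orePoly_pow, orePoly_zero, Polynomial.coeff_zero]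

variable [FiniteDimensional F L]

theorem IsFrobCharPoly.frobEnd_sq {h f : F[X]} (hξ : φ.IsFrobCharPoly h f) :
    frobEnd F L Ω ^ 2 = φ.act f - φ.act h * frobEnd F L Ω := by
  rw [eq_sub_iff_add_eq, ← sub_eq_zero]
  exact hξ.1

/-- Since φ_f = (τ_L + φ_h) τ_L is right divisible by τ_L, it has no term in τ^0. -/
theorem IsFrobCharPoly.map_eq_zero [Infinite Ω] {h f : F[X]} (hξ : φ.IsFrobCharPoly h f) :
    γ f = 0 := by
  have hq : 1 < Fintype.card F := Fintype.one_lt_card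
  let T : oreRing F L Ω := ⟨frobEnd F L Ω, frobEnd_mem F L Ω⟩
  have hT : orePoly T = X ^ Fintype.card F ^ Module.finrank F L :=
    orePoly_eq fun z => by simp [T, frobEnd]
  have h1 : φ.toAlgHom f = (T + φ.toAlgHom h) * T := by
    refine Subtype.ext ?_
    change φ.act f = (frobEnd F L Ω + φ.act h) * frobEnd F L Ω
    rw [add_mul, ← sq, hξ.frobEnd_sq, sub_add_cancel]
  rw [← φ.coeff_zero, ← coeff_orePoly_pow, h1, orePoly_mul, hT, ← expand_eq_comp_X_pow,
    coeff_expand (by positivity), if_neg]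
  rw [pow_zero, Nat.dvd_one]
  exact (Nat.one_lt_pow Module.finrank_pos.ne' hq).ne'

theorem IsFrobCharPoly.exists_frobEnd_pow_eq [Infinite Ω] {h f : F[X]}
    (hξ : φ.IsFrobCharPoly h f) (hh : γ h ≠ 0) (m : ℕ) :
    ∃ a b : F[X], frobEnd F L Ω ^ (m + 1) = φ.act a * frobEnd F L Ω + φ.act b ∧
      γ a ≠ 0 ∧ γ b = 0 := by
  induction m with
  | zero => exact ⟨1, 0, by simp [act_one, act_zero], by simp, by simp⟩
  | succ m ih =>
    obtain ⟨a, b, hab, ha, hb⟩ := ih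
    -- From (a τ_L + b) τ_L with τ_L^2 = f - h τ_L. Under γ, which kills b and f, the new a becomes
    -- -γ(a) γ(h).
    refine ⟨b - a * h, a * f, ?_, ?_, ?_⟩
    · rw [pow_succ, hab, add_mul, mul_assoc, ← sq, hξ.frobEnd_sq, act_sub, act_mul, act_mul,
        mul_sub, sub_mul, mul_assoc (φ.act a) (φ.act h)]
      abel
    · simpa [hb] using ⟨ha, hh⟩
    · simp [hξ.map_eq_zero]

/-- For an ordinary Drinfeld module of rank two over a finite field, all endomorphisms over an
algebraic closure are defined over the base field. -/
theorem endRing_eq_of_isOrdinary [IsAlgClosure L Ω] (hord : φ.IsOrdinary) {h f : F[X]}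
    (hξ : φ.IsFrobCharPoly h f) : φ.endRing Ω = φ.endRing L := by
  have : IsAlgClosed Ω := IsAlgClosure.isAlgClosed L
  have : Algebra.IsAlgebraic L Ω := IsAlgClosure.isAlgebraic
  have : Infinite Ω := IsAlgClosed.instInfinite
  have hh : γ h ≠ 0 := fun h0 => hord ⟨h, f, hξ, h0⟩
  ext P
  rw [mem_endRing, mem_endRing]
  refine ⟨fun ⟨hP, hc⟩ => ⟨mem_oreRing_of_frobEnd_mul_comm hP ?_, hc⟩,
    fun ⟨hP, hc⟩ => ⟨oreRing_mono hP, hc⟩⟩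
  obtain ⟨m, hm, hcm⟩ := exists_frobEnd_pow_mul_comm (L := L) hP
  obtain ⟨m, rfl⟩ := Nat.exists_eq_succ_of_ne_zero hm.ne'
  obtain ⟨a, b, hab, ha, -⟩ := hξ.exists_frobEnd_pow_eq hh m
  rw [Nat.succ_eq_add_one, hab] at hcm
  have hT : frobEnd F L Ω ∈ oreRing F Ω Ω := oreRing_mono (frobEnd_mem F L Ω)
  -- P commutes with φ_a, φ_b and φ_a τ_L + φ_b.
  have h0 : φ.act a * (frobEnd F L Ω * P - P * frobEnd F L Ω) = 0 := by
    rw [mul_sub, ← mul_assoc, ← mul_assoc, ← hc a, sub_eq_zero, mul_assoc P]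
    rw [add_mul, mul_add, hc b] at hcm
    exact add_right_cancel hcm
  refine sub_eq_zero.1 ((mul_eq_zero_of_mem_oreRing (oreRing_mono (act_mem φ a))
    (sub_mem (mul_mem hT hP) (mul_mem hP hT)) h0).resolve_left fun h1 => ha (act_eq_zero_imp h1))

end Act

end DrinfeldModule

namespace DrinfeldModule

variable {F : Type*} [Field F] [Fintype F]
variable {L : Type*} [Field L] [Algebra F L] [FiniteDimensional F L]
variable {Ω : Type*} [Field Ω] [Algebra F Ω] [Algebra L Ω] [IsScalarTower F L Ω] [Infinite Ω]

/-! ### Division with remainder by F[X] + F[X] τ_L -/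

section OreRing

variable (F L Ω) in
/-- The Frobenius endomorphism as an element of the ring of Ore polynomials. -/
def oreFrob : oreRing F L Ω := ⟨frobEnd F L Ω, frobEnd_mem F L Ω⟩

variable (F L Ω) in
theorem oreFrob_ne_zero : oreFrob F L Ω ≠ 0 := by
  intro h
  have := LinearMap.congr_fun (congrArg Subtype.val h) 1
  simp [oreFrob, frobEnd] at this

variable (F L Ω) in
theorem tauDegree_oreFrob : tauDegree (oreFrob F L Ω) = Module.finrank F L := by
  have h : orePoly (oreFrob F L Ω) = X ^ Fintype.card F ^ Module.finrank F L :=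
    orePoly_eq fun z => by simp [oreFrob, frobEnd]
  exact tauDegree_eq_of_natDegree (oreFrob_ne_zero F L Ω) (by rw [h, natDegree_X_pow])

theorem commute_oreFrob (P : oreRing F L Ω) : Commute P (oreFrob F L Ω) :=
  Subtype.ext (frobEnd_mul_comm P.2).symm

/-- u is fixed by the q^2-power map and, lying in L, by the q^n-power map with n odd, hence by the
q-power map. -/
theorem exists_algebraMap_eq_of_pow_sq (hodd : Odd (Module.finrank F L)) {u : L}
    (hu : u ^ Fintype.card F ^ 2 = u) : ∃ v : F, algebraMap F L v = u := by
  obtain ⟨k, hk⟩ := hodd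
  apply exists_algebraMap_eq_of_pow_card_eq
  have h := pow_card_pow_finrank (F := F) u
  rwa [hk, pow_succ, pow_mul u, pow_pow_mul_eq_self hu] at h

variable {γ : F[X] →ₐ[F] L} {φ : DrinfeldModule γ Ω}

theorem HasRank.toAlgHom_ne_zero {r : ℕ} (hrank : φ.HasRank r) {a : F[X]} (ha : a ≠ 0) :
    φ.toAlgHom a ≠ 0 := by
  intro h
  -- As `tauDegree` is 0 at 0, the rank formula at a alone says nothing for constant a; the factor X
  -- makes the degree positive.
  have h1 := hrank.2 (a * X) (mul_ne_zero ha X_ne_zero)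
  rw [map_mul, h, zero_mul, tauDegree_zero, natDegree_mul_X ha] at h1
  exact (mul_pos hrank.1 (Nat.succ_pos _)).ne h1

/-- The two terms, when nonzero, have τ-degrees of opposite parity and cannot cancel. -/
theorem eq_zero_and_eq_zero_of_add_mul_eq_zero (hodd : Odd (Module.finrank F L))
    (hrank : φ.HasRank 2) {s t : F[X]}
    (h : φ.toAlgHom s + φ.toAlgHom t * oreFrob F L Ω = 0) : s = 0 ∧ t = 0 := by
  have ht : t = 0 := by
    by_contra ht
    have h1 : φ.toAlgHom (-s) = φ.toAlgHom t * oreFrob F L Ω := by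
      rw [map_neg, neg_eq_iff_add_eq_zero, h]
    have hne : φ.toAlgHom t * oreFrob F L Ω ≠ 0 :=
      mul_ne_zero (hrank.toAlgHom_ne_zero ht) (oreFrob_ne_zero F L Ω)
    have hs : -s ≠ 0 := by
      intro hs
      rw [hs, map_zero] at h1
      exact hne h1.symm
    have h2 := congrArg tauDegree h1
    rw [tauDegree_mul (hrank.toAlgHom_ne_zero ht) (oreFrob_ne_zero F L Ω), hrank.2 _ hs,
      hrank.2 _ ht, tauDegree_oreFrob] at h2
    obtain ⟨k, hk⟩ := hodd
    omega
  refine ⟨?_, ht⟩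
  by_contra hs
  rw [ht, map_zero, zero_mul, add_zero] at h
  exact hrank.toAlgHom_ne_zero hs h

/-- Modulo `F[X] + F[X] τ_L`, every endomorphism is congruent to one of `τ`-degree less than
`[L : F]`. -/
theorem exists_eq_add_mul_add (hodd : Odd (Module.finrank F L)) (hrank : φ.HasRank 2)
    (P : oreRing F L Ω) (hP : ∀ a, Commute P (φ.toAlgHom a)) :
    ∃ (s t : F[X]) (R : oreRing F L Ω), tauDegree R < Module.finrank F L ∧
      P = φ.toAlgHom s + φ.toAlgHom t * oreFrob F L Ω + R := by
  induction hd : tauDegree P using Nat.strong_induction_on generalizing P with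
  | _ d ih =>
  by_cases hdn : d < Module.finrank F L
  · exact ⟨0, 0, P, hd ▸ hdn, by simp⟩
  have hn : 0 < Module.finrank F L := Module.finrank_pos
  have hP0 : P ≠ 0 := by
    rintro rfl
    rw [tauDegree_zero] at hd
    omega
  obtain ⟨s, t, hne, hdeg⟩ : ∃ s t : F[X], φ.toAlgHom s + φ.toAlgHom t * oreFrob F L Ω ≠ 0 ∧
      tauDegree (φ.toAlgHom s + φ.toAlgHom t * oreFrob F L Ω) = d := by
    have hX : ∀ k : ℕ, (X ^ k : F[X]) ≠ 0 := fun k => pow_ne_zero _ X_ne_zero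
    rcases Nat.even_or_odd' d with ⟨k, rfl | rfl⟩
    · refine ⟨X ^ k, 0, ?_, ?_⟩
      · rw [map_zero, zero_mul, add_zero]
        exact hrank.toAlgHom_ne_zero (hX k)
      · rw [map_zero, zero_mul, add_zero, hrank.2 _ (hX k), natDegree_X_pow]
    · obtain ⟨l, hl⟩ := hodd
      -- Here d = 2k + 1 and n = 2l + 1 with d ≥ n, so the subtraction is not truncated.
      refine ⟨0, X ^ (k - l), ?_, ?_⟩
      · rw [map_zero, zero_add]
        exact mul_ne_zero (hrank.toAlgHom_ne_zero (hX _)) (oreFrob_ne_zero F L Ω)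
      · rw [map_zero, zero_add, tauDegree_mul (hrank.toAlgHom_ne_zero (hX _))
          (oreFrob_ne_zero F L Ω), hrank.2 _ (hX _), natDegree_X_pow, tauDegree_oreFrob]
        omega
  set R := φ.toAlgHom s + φ.toAlgHom t * oreFrob F L Ω with hR
  have hRc : ∀ a, Commute R (φ.toAlgHom a) := fun a =>
    ((Commute.all s a).map φ.toAlgHom).add_left
      (((Commute.all t a).map φ.toAlgHom).mul_left (commute_oreFrob _).symm)
  -- P and R commute with φ_X, of τ-degree 2, so the ratio of leading coefficients is fixed by the
  -- q^2-power map and lies in F.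
  have hu := leadingCoeff_div_pow_eq hP0 hne (hrank.toAlgHom_ne_zero X_ne_zero)
    (hd.trans hdeg.symm) (hP X) (hRc X)
  rw [hrank.2 X X_ne_zero, natDegree_X, mul_one] at hu
  obtain ⟨v, hv⟩ := exists_algebraMap_eq_of_pow_sq hodd hu
  have hlR : (orePoly R).leadingCoeff ≠ 0 := leadingCoeff_ne_zero.2 (mt orePoly_eq_zero_iff.1 hne)
  have hlP : (orePoly P).leadingCoeff ≠ 0 := leadingCoeff_ne_zero.2 (mt orePoly_eq_zero_iff.1 hP0)
  have hv0 : v ≠ 0 := by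
    rintro rfl
    rw [map_zero] at hv
    exact div_ne_zero hlP hlR hv.symm
  have hlt : tauDegree (P - v • R) < d := by
    rw [← hd]
    refine tauDegree_sub_lt hP0 (smul_ne_zero hv0 hne) ?_ (by omega) ?_
    · rw [tauDegree_smul hv0, hdeg, hd]
    · rw [orePoly_smul, leadingCoeff_mul, leadingCoeff_C, hv, div_mul_cancel₀ _ hlR]
  have hc : ∀ a, Commute (P - v • R) (φ.toAlgHom a) := fun a => by
    have h1 : Commute (P : Module.End F Ω) (φ.act a) := congrArg Subtype.val (hP a)
    have h2 : Commute (R : Module.End F Ω) (φ.act a) := congrArg Subtype.val (hRc a)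
    exact Subtype.ext (h1.sub_left (h2.smul_left v))
  obtain ⟨s', t', R', hR', h'⟩ := ih _ hlt (P - v • R) hc rfl
  refine ⟨s' + v • s, t' + v • t, R', hR', ?_⟩
  have hPR : P = P - v • R + v • R :=
    Subtype.ext (sub_add_cancel (P : Module.End F Ω) ((v • R : oreRing F L Ω) : _)).symm
  rw [hPR, h', hR, map_add, map_add, map_smul, map_smul, add_mul, smul_add,
    smul_mul_assoc]
  abel

end OreRing

/-! ### Structure of the endomorphism ring over L -/

section EndRing

variable {γ : F[X] →ₐ[F] L} (φ : DrinfeldModule γ Ω)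

theorem act_mem_endRing (a : F[X]) : φ.act a ∈ φ.endRing L :=
  (mem_endRing _ _ _).2 ⟨act_mem φ a, fun b => act_mul_comm φ a b⟩

theorem frobEnd_mem_endRing : frobEnd F L Ω ∈ φ.endRing L :=
  (mem_endRing _ _ _).2 ⟨frobEnd_mem F L Ω, fun b => frobEnd_mul_comm (act_mem φ b)⟩

/-- `a ↦ φ_a`, as a morphism to the endomorphism ring of `φ`. -/
def actEnd : F[X] →ₐ[F] φ.endRing L :=
  ((oreRing F L Ω).val.comp φ.toAlgHom).codRestrict _ (act_mem_endRing φ)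

/-- The Frobenius endomorphism, as an element of the endomorphism ring of `φ`. -/
def frobEndRing : φ.endRing L := ⟨frobEnd F L Ω, frobEnd_mem_endRing φ⟩

/-- The inclusion of the endomorphism ring into the ring of Ore polynomials. -/
def endRingToOre : φ.endRing L →ₐ[F] oreRing F L Ω := Subalgebra.inclusion inf_le_left

theorem endRingToOre_injective : Function.Injective φ.endRingToOre :=
  Subalgebra.inclusion_injective _

theorem commute_actEnd (x : φ.endRing L) (a : F[X]) : Commute x (φ.actEnd a) :=
  Subtype.ext (((mem_endRing _ _ _).1 x.2).2 a)

theorem commute_frobEndRing (x : φ.endRing L) : Commute x φ.frobEndRing :=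
  Subtype.ext (frobEnd_mul_comm ((mem_endRing _ _ _).1 x.2).1).symm

theorem noZeroDivisors_endRing : NoZeroDivisors (φ.endRing L) :=
  φ.endRingToOre_injective.noZeroDivisors _ (map_zero _) (map_mul _)

variable {φ}

theorem eq_zero_and_eq_zero_of_actEnd_add_mul_eq_zero (hodd : Odd (Module.finrank F L))
    (hrank : φ.HasRank 2) {s t : F[X]} (h : φ.actEnd s + φ.actEnd t * φ.frobEndRing = 0) :
    s = 0 ∧ t = 0 :=
  eq_zero_and_eq_zero_of_add_mul_eq_zero hodd hrank (congrArg φ.endRingToOre h)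

theorem exists_finite_forall_eq_add_mul_add (hodd : Odd (Module.finrank F L))
    (hrank : φ.HasRank 2) :
    ∃ W : Set (φ.endRing L), W.Finite ∧ ∀ x : φ.endRing L, ∃ (s t : F[X]), ∃ w ∈ W,
      x = φ.actEnd s + φ.actEnd t * φ.frobEndRing + w := by
  have : Finite L := Module.finite_of_finite F
  refine ⟨φ.endRingToOre ⁻¹' {P | tauDegree P < Module.finrank F L},
    (finite_setOf_tauDegree_lt _).preimage φ.endRingToOre_injective.injOn, fun x => ?_⟩
  obtain ⟨s, t, R, hR, hx⟩ := exists_eq_add_mul_add hodd hrank (φ.endRingToOre x)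
    (fun a => Subtype.ext (((mem_endRing _ _ _).1 x.2).2 a))
  have hR' : φ.endRingToOre (x - (φ.actEnd s + φ.actEnd t * φ.frobEndRing)) = R := by
    refine Subtype.ext ?_
    change (x : Module.End F Ω) - (φ.act s + φ.act t * frobEnd F L Ω) = R
    rw [show (x : Module.End F Ω) = φ.act s + φ.act t * frobEnd F L Ω + R from
      congrArg Subtype.val hx, add_sub_cancel_left]
  exact ⟨s, t, _, by rwa [Set.mem_preimage, hR'], by abel⟩

/-- Pigeonhole: F[X] is infinite and remainders are finite in number, so two distinct multiples of x
share a remainder; subtract them. -/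
theorem exists_actEnd_mul_eq (hodd : Odd (Module.finrank F L)) (hrank : φ.HasRank 2)
    (x : φ.endRing L) :
    ∃ a s t : F[X], a ≠ 0 ∧ φ.actEnd a * x = φ.actEnd s + φ.actEnd t * φ.frobEndRing := by
  obtain ⟨W, hW, h⟩ := exists_finite_forall_eq_add_mul_add hodd hrank
  choose s t w hw hx using fun a : F[X] => h (φ.actEnd a * x)
  have := hW.to_subtype
  obtain ⟨a, b, hab, heq⟩ := Finite.exists_ne_map_eq_of_infinite fun a : F[X] => (⟨w a, hw a⟩ : W)
  have heq' : w a = w b := congrArg Subtype.val heq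
  refine ⟨a - b, s a - s b, t a - t b, sub_ne_zero.2 hab, ?_⟩
  have hs : φ.actEnd (s a) = φ.actEnd (s a - s b) + φ.actEnd (s b) := by
    rw [← map_add, sub_add_cancel]
  have ht : φ.actEnd (t a) = φ.actEnd (t a - t b) + φ.actEnd (t b) := by
    rw [← map_add, sub_add_cancel]
  refine add_right_cancel (b := φ.actEnd b * x) ?_
  rw [← add_mul, ← map_add, sub_add_cancel, hx a, hx b, heq', hs, ht, add_mul]
  abel

/-- A nonzero multiple φ_a x lies in F[X][τ_L], which is central, and φ_a can be cancelled. -/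
theorem endRing_mul_comm (hodd : Odd (Module.finrank F L)) (hrank : φ.HasRank 2)
    (x y : φ.endRing L) : x * y = y * x := by
  obtain ⟨a, s, t, ha, h⟩ := exists_actEnd_mul_eq hodd hrank x
  have ha' : φ.act a ≠ 0 := fun h0 => hrank.toAlgHom_ne_zero ha (Subtype.ext h0)
  have hy : Commute y (φ.actEnd a * x) := by
    rw [h]
    exact (commute_actEnd φ y s).add_right
      ((commute_actEnd φ y t).mul_right (commute_frobEndRing φ y))
  have hxy : φ.actEnd a * (x * y) = φ.actEnd a * (y * x) := by
    rw [← mul_assoc, ← hy.eq, ← mul_assoc, (commute_actEnd φ y a).eq, mul_assoc]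
  have h0 : φ.act a * ((x : Module.End F Ω) * y - y * x) = 0 := by
    rw [mul_sub, sub_eq_zero]
    exact congrArg Subtype.val hxy
  have hx := ((mem_endRing _ _ _).1 x.2).1
  have hy := ((mem_endRing _ _ _).1 y.2).1
  exact Subtype.ext (sub_eq_zero.1 ((mul_eq_zero_of_mem_oreRing (act_mem φ a)
    (sub_mem (mul_mem hx hy) (mul_mem hy hx)) h0).resolve_left ha'))

theorem IsFrobCharPoly.frobEndRing_sq {h f : F[X]} (hξ : φ.IsFrobCharPoly h f) :
    φ.frobEndRing ^ 2 + φ.actEnd h * φ.frobEndRing - φ.actEnd f = 0 :=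
  Subtype.ext hξ.1

/-- The order `F[X][τ_L]` is all of the endomorphism ring when it is smooth. -/
theorem exists_eq_actEnd_add_mul (hodd : Odd (Module.finrank F L)) (hrank : φ.HasRank 2)
    {h f : F[X]} (hξ : φ.IsFrobCharPoly h f)
    (hsm : ∀ x y : AlgebraicClosure F, y ^ 2 + aeval x h * y - aeval x f = 0 →
      ¬ (2 * y + aeval x h = 0 ∧ aeval x (derivative h) * y - aeval x (derivative f) = 0))
    (x : φ.endRing L) : ∃ s t : F[X], x = φ.actEnd s + φ.actEnd t * φ.frobEndRing := by
  let _ : CommRing (φ.endRing L) :=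
    { (inferInstance : Ring (φ.endRing L)) with mul_comm := endRing_mul_comm hodd hrank }
  have := noZeroDivisors_endRing φ
  have : IsDomain (φ.endRing L) := NoZeroDivisors.to_isDomain _
  let _ : Algebra F[X] (φ.endRing L) := φ.actEnd.toRingHom.toAlgebra
  -- The remainders together with 1 and τ_L generate the module; finiteness supplies the integrality
  -- needed for the normality argument.
  have hfin : Module.Finite F[X] (φ.endRing L) := by
    obtain ⟨W, hW, hx⟩ := exists_finite_forall_eq_add_mul_add hodd hrank
    refine ⟨⟨(hW.union (Set.toFinite {1, φ.frobEndRing})).toFinset, ?_⟩⟩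
    rw [Set.Finite.coe_toFinset, eq_top_iff]
    rintro x -
    obtain ⟨s, t, w, hw, rfl⟩ := hx x
    have h1 : φ.actEnd s = s • (1 : φ.endRing L) := (mul_one _).symm
    have h2 : φ.actEnd t * φ.frobEndRing = t • φ.frobEndRing := rfl
    rw [h1, h2]
    exact add_mem (add_mem (Submodule.smul_mem _ _ (Submodule.subset_span (by simp)))
      (Submodule.smul_mem _ _ (Submodule.subset_span (by simp))))
      (Submodule.subset_span (Or.inl hw))
  obtain ⟨a, s, t, ha, hax⟩ := exists_actEnd_mul_eq hodd hrank x
  exact exists_eq_add_mul_of_mul hsm (y := φ.frobEndRing) hξ.frobEndRing_sq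
    (fun s t => eq_zero_and_eq_zero_of_actEnd_add_mul_eq_zero hodd hrank) ha x ⟨s, t, hax⟩

theorem monic_quadPoly (h f : F[X]) : (quadPoly h f).Monic := by
  unfold quadPoly
  monicity!

theorem natDegree_quadPoly (h f : F[X]) : (quadPoly h f).natDegree = 2 := by
  unfold quadPoly
  compute_degree!

theorem exists_eq_of_add_mul_root {h f : F[X]} (z : AdjoinRoot (quadPoly h f)) :
    ∃ s t : F[X], z = AdjoinRoot.of _ s + AdjoinRoot.of _ t * AdjoinRoot.root _ := by
  obtain ⟨g, rfl⟩ := AdjoinRoot.mk_surjective z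
  have hdeg : (g %ₘ quadPoly h f).natDegree ≤ 1 := by
    have := natDegree_modByMonic_lt g (monic_quadPoly h f) (fun h1 => by
      simpa [h1] using natDegree_quadPoly h f)
    rw [natDegree_quadPoly] at this
    omega
  refine ⟨(g %ₘ quadPoly h f).coeff 0, (g %ₘ quadPoly h f).coeff 1, ?_⟩
  have h1 : AdjoinRoot.mk (quadPoly h f) g = AdjoinRoot.mk _ (g %ₘ quadPoly h f) := by
    rw [AdjoinRoot.mk_eq_mk]
    exact ⟨g /ₘ quadPoly h f, by
      rw [sub_eq_iff_eq_add', modByMonic_add_div]⟩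
  rw [h1]
  conv_lhs => rw [eq_X_add_C_of_natDegree_le_one hdeg]
  simp [add_comm]

end EndRing

end DrinfeldModule

end

theorem mainTheorem6 {F : Type*} [Field F] [Fintype F]
    {L : Type*} [Field L] [Algebra F L] [FiniteDimensional F L]
    {Ω : Type*} [Field Ω] [Algebra F Ω] [Algebra L Ω] [IsScalarTower F L Ω] [IsAlgClosure L Ω]
    (hodd : Odd (Module.finrank F L))
    (γ : F[X] →ₐ[F] L) (φ : DrinfeldModule γ Ω) (hrank : φ.HasRank 2)
    (hord : φ.IsOrdinary)
    (h f : F[X]) (hξ : φ.IsFrobCharPoly h f) (hcurve : IsImaginaryHyperelliptic h f) :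
    φ.endRing Ω = φ.endRing L ∧
      ∃ e : AdjoinRoot (DrinfeldModule.quadPoly h f) ≃ₐ[F] φ.endRing L,
        (e (AdjoinRoot.of _ X) : Module.End F Ω) = φ.act X ∧
        (e (AdjoinRoot.root _) : Module.End F Ω) = DrinfeldModule.frobEnd F L Ω := by
  refine ⟨DrinfeldModule.endRing_eq_of_isOrdinary hord hξ, ?_⟩
  have : IsAlgClosed Ω := IsAlgClosure.isAlgClosed L
  have : Infinite Ω := IsAlgClosed.instInfinite
  -- `AdjoinRoot.lift` needs a commutative target.
  let _ : CommRing (φ.endRing L) :=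
    { (inferInstance : Ring (φ.endRing L)) with
      mul_comm := DrinfeldModule.endRing_mul_comm hodd hrank }
  have hroot : (DrinfeldModule.quadPoly h f).eval₂ (φ.actEnd : F[X] →+* φ.endRing L)
      φ.frobEndRing = 0 := by
    simpa [DrinfeldModule.quadPoly] using hξ.frobEndRing_sq
  let e₀ : AdjoinRoot (DrinfeldModule.quadPoly h f) →+* φ.endRing L :=
    AdjoinRoot.lift (φ.actEnd : F[X] →+* φ.endRing L) φ.frobEndRing hroot
  have hof : ∀ s, e₀ (AdjoinRoot.of _ s) = φ.actEnd s := fun s => AdjoinRoot.lift_of hroot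
  have hrt : e₀ (AdjoinRoot.root _) = φ.frobEndRing := AdjoinRoot.lift_root hroot
  let e₁ : AdjoinRoot (DrinfeldModule.quadPoly h f) →ₐ[F] φ.endRing L :=
    { e₀ with
      commutes' := fun r => (hof (algebraMap F F[X] r)).trans (φ.actEnd.commutes r) }
  have hinj : Function.Injective e₁ := by
    rw [injective_iff_map_eq_zero]
    intro z hz
    obtain ⟨s, t, rfl⟩ := DrinfeldModule.exists_eq_of_add_mul_root z
    change e₀ _ = 0 at hz
    rw [map_add, map_mul, hof, hof, hrt] at hz
    obtain ⟨rfl, rfl⟩ :=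
      DrinfeldModule.eq_zero_and_eq_zero_of_actEnd_add_mul_eq_zero hodd hrank hz
    simp
  have hsurj : Function.Surjective e₁ := by
    intro x
    obtain ⟨s, t, rfl⟩ := DrinfeldModule.exists_eq_actEnd_add_mul hodd hrank hξ hcurve.2 x
    refine ⟨AdjoinRoot.of _ s + AdjoinRoot.of _ t * AdjoinRoot.root _, ?_⟩
    change e₀ _ = _
    rw [map_add, map_mul, hof, hof, hrt]
  exact ⟨AlgEquiv.ofBijective e₁ ⟨hinj, hsurj⟩, congrArg Subtype.val (hof X),
    congrArg Subtype.val hrt⟩
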